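/- Consider $M$ users and $N$ options, in discrete time $t=1,2,\dots$, and let $1\le K\le N$. At time $t$ option $j$ would give user $i$ a reward $X^i_j(t)\in[0,1]$. For each $(i,j)$ the rewards are identically distributed over time with mean $\mu^i_j$, and the rewards at a time are independent of everything that happened before. For every user the means of different options are distinct, and all users order the options by mean reward in the same way (uniform preference). Let $N^i_K$ be the set of the $K$ options with the highest means for user $i$, $\overline N^i_K$ its complement, and $\Delta^i_j=\min_{l\in N^i_K}\mu^i_l-\mu^i_j$ for $j\in\overline N^i_K$. Let $a^i(t)$ be the set of options chosen by user $i$ at time $t$. Users announce their choices but not their rewards. Let $n^i_j(t)$ be the number of times user $i$ has chosen option $j$ in the steps $1,\dots,t$, let $r^i_j(t)$ be the average of the rewards user $i$ obtained from these choices, $n_j(t)=\sum_i n^i_j(t)$ and $\beta_j(t)=n_j(t)/\sum_l n_l(t)$. Fix a weight $\alpha\ge 0$. Under the algorithm U\_PART, each user $i$ chooses at each time $t+1$ exactly $K$ options whose indices $$r^i_j(t)-\alpha\,(1-\beta_j(t))\sqrt{\frac{\log t}{t}}+\sqrt{\frac{2\log t}{n^i_j(t)}}$$ are the $K$ highest,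 where the index is $+\infty$ if $n^i_j(t)=0$ and ties are broken in any way that does not use present or future rewards. The weak regret of user $i$ is $$R^i(t)=t\sum_{j\in N^i_K}\mu^i_j-\mathbb E\Big[\sum_{m=1}^{t}\sum_{j\in a^i(m)}X^i_j(m)\Big].$$ Then, if all users follow U\_PART, for every $\varepsilon>0$ there is a constant $C$, which depends only on $M$, $N$, $K$, the means $\mu^i_j$, $\alpha$ and $\varepsilon$, such that for every user $i$ and every $t\ge 1$ $$R^i(t)\le\sum_{j\in\overline N^i_K}\left\lceil\frac{(6+\varepsilon)\log t}{\Delta^i_j}\right\rceil+C.$$ -/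

import Mathlib

open MeasureTheory ProbabilityTheory

namespace GroupLearning

noncomputable section

/-- The set `N_K` of the `K` options with the highest mean rewards, for a vector `m` of (pairwise
distinct) means: the options that are beaten by fewer than `K` options. -/
def topOptions {N : ℕ} (K : ℕ) (m : Fin N → ℝ) : Finset (Fin N) :=
  {j | (Finset.univ.filter fun l => m j < m l).card < K}

/-- The gap `Δ_j` between the `K`-th highest mean and the mean of option `j`. -/
def gap {N : ℕ} (K : ℕ) (m : Fin N → ℝ) (j : Fin N) : ℝ :=
  sInf (m '' (topOptions K m : Set (Fin N))) - m j

/-- Different options have different mean rewards for every user, and all users order the options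
in the same way. -/
structure UniformPreference {M N : ℕ} (μ : Fin M → Fin N → ℝ) : Prop where
  distinct : ∀ i, Function.Injective (μ i)
  sameOrder : ∀ i k j₁ j₂, μ i j₂ < μ i j₁ → μ k j₂ < μ k j₁

section Counts

variable {M N : ℕ} {Ω : Type*}

/-- `n^i_j(t)`: the number of times user `i` has selected option `j` in the steps `1, …, t`. -/
def userCount (a : ℕ → Fin M → Ω → Finset (Fin N)) (t : ℕ) (i : Fin M) (j : Fin N) (ω : Ω) : ℕ :=
  ((Finset.Icc 1 t).filter fun m => j ∈ a m i ω).card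

/-- `n_j(t)`: the number of times option `j` has been selected by the whole group. -/
def groupCount (a : ℕ → Fin M → Ω → Finset (Fin N)) (t : ℕ) (j : Fin N) (ω : Ω) : ℕ :=
  ∑ i, userCount a t i j ω

/-- The group frequency `β_j(t) = n_j(t) / ∑ l, n_l(t)`. -/
def groupFreq (a : ℕ → Fin M → Ω → Finset (Fin N)) (t : ℕ) (j : Fin N) (ω : Ω) : ℝ :=
  (groupCount a t j ω : ℝ) / ∑ l, (groupCount a t l ω : ℝ)

/-- `r^i_j(t)`: the mean of the rewards that user `i` has itself collected from option `j`
in the steps `1, …, t`. -/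
def sampleMean (X : ℕ → Fin M → Fin N → Ω → ℝ) (a : ℕ → Fin M → Ω → Finset (Fin N))
    (t : ℕ) (i : Fin M) (j : Fin N) (ω : Ω) : ℝ :=
  (∑ m ∈ (Finset.Icc 1 t).filter (fun m => j ∈ a m i ω), X m i j ω) / userCount a t i j ω

/-- The U_PART index of option `j` for user `i`, computed from the rewards of user `i` and the
choices of all users in the steps `1, …, t`. An option which user `i` has not yet tried has
index `+∞`. -/
def upartIndex (α : ℝ) (X : ℕ → Fin M → Fin N → Ω → ℝ) (a : ℕ → Fin M → Ω → Finset (Fin N))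
    (t : ℕ) (i : Fin M) (j : Fin N) (ω : Ω) : EReal :=
  if userCount a t i j ω = 0 then ⊤
  else ((sampleMean X a t i j ω
      - α * (1 - groupFreq a t j ω) * √(Real.log t / t)
      + √(2 * Real.log t / userCount a t i j ω) : ℝ) : EReal)

end Counts

section Model

variable {M N : ℕ} {Ω : Type*} [mΩ : MeasurableSpace Ω]

/-- `X t i j` is the reward of option `j` for user `i` at time `t = 1, 2, …`. For each user and
option the rewards are identically distributed over time, take values in `[0, 1]` and have mean
`μ i j`; all rewards at a time are independent of the past. The filtration `ℱ t` is the information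
available after step `t` (past rewards, and possibly randomization used to break ties).
Nothing is assumed about the joint law of the rewards of different users or options
at the same time. -/
structure IsRewardProcess (P : Measure Ω) (ℱ : Filtration ℕ mΩ) (μ : Fin M → Fin N → ℝ)
    (X : ℕ → Fin M → Fin N → Ω → ℝ) : Prop where
  adapted : ∀ t, 1 ≤ t → ∀ i j, Measurable[ℱ t] (X t i j)
  indep_past : ∀ t, Indep
    (MeasurableSpace.comap (fun ω (i : Fin M) (j : Fin N) => X (t + 1) i j ω) inferInstance)
    (ℱ t) P
  identDistrib : ∀ s t, 1 ≤ s → 1 ≤ t → ∀ i j, IdentDistrib (X s i j) (X t i j) P P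
  mem_unit : ∀ t, 1 ≤ t → ∀ i j, ∀ᵐ ω ∂P, X t i j ω ∈ Set.Icc (0 : ℝ) 1
  mean : ∀ t, 1 ≤ t → ∀ i j, ∫ ω, X t i j ω ∂P = μ i j

/-- `a t i` is the set of options chosen by user `i` at time `t = 1, 2, …`, when all users follow
U_PART with weight `α`: at step `t + 1` every user selects `K` options whose indices, computed from
the observations of the steps `1, …, t`, are the `K` highest. Ties are broken arbitrarily,
without looking into the future. -/
structure IsUPart (ℱ : Filtration ℕ mΩ) (K : ℕ) (α : ℝ)
    (X : ℕ → Fin M → Fin N → Ω → ℝ) (a : ℕ → Fin M → Ω → Finset (Fin N)) : Prop where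
  predictable : ∀ t i j, MeasurableSet[ℱ t] {ω | j ∈ a (t + 1) i ω}
  card_eq : ∀ t i ω, (a (t + 1) i ω).card = K
  highest : ∀ t i ω, ∀ j ∈ a (t + 1) i ω, ∀ l ∉ a (t + 1) i ω,
    upartIndex α X a t i l ω ≤ upartIndex α X a t i j ω

/-- The weak regret of user `i` up to time `T`. -/
def weakRegret (P : Measure Ω) (K : ℕ) (μ : Fin M → Fin N → ℝ)
    (X : ℕ → Fin M → Fin N → Ω → ℝ) (a : ℕ → Fin M → Ω → Finset (Fin N))
    (i : Fin M) (T : ℕ) : ℝ :=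
  T * ∑ j ∈ topOptions K (μ i), μ i j
    - ∫ ω, ∑ t ∈ Finset.Icc 1 T, ∑ j ∈ a t i ω, X t i j ω ∂P

end Model

end

end GroupLearning

/-!
For a suboptimal option that has been chosen `n` times, the reward collected so far minus `n` times
its mean is a sum of sub-Gaussian increments sampled at predictable times, and its exponential
weights have decreasing expectation. Hence, with bounded expected cost, we may assume that the
sample mean of a chosen option is not too high by a small multiple of the gap and that no mean lies
above its confidence interval; the group term of the index tends to zero and is negligible as well.
Then choosing `j` instead of a top option `l` forces
`μ l - μ j ≤ (small multiple of the gap) + √(2 log t / n)`. Such a step therefore costs at most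
`r / √n` with `r ≈ √(2 log T)`, and nothing once `r / √n` is smaller than the gap `Δ`. Since
`∑ k ≤ n, 1 / √k ≤ 2 √n`, the total cost of `j` is about `2 r ^ 2 / Δ ≈ 4 log T / Δ`. Charging the
swap loss `μ l - μ j`, rather than `Δ`, to each choice of `j` matters because `l` need not be the
worst top option.
-/

open Filter Topology
open scoped NNReal

namespace GroupLearning

section SampledSums

variable {Ω : Type*}

/-- The number of steps `m < t` at which the arm with pull events `B` is pulled. -/
noncomputable def pullCount (B : ℕ → Set Ω) (t : ℕ) (ω : Ω) : ℕ :=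
  ∑ m ∈ Finset.range t, (B m).indicator 1 ω

/-- The sum of the rewards `Y m` over the steps `m < t` at which the arm is pulled. -/
noncomputable def pullSum (B : ℕ → Set Ω) (Y : ℕ → Ω → ℝ) (t : ℕ) (ω : Ω) : ℝ :=
  ∑ m ∈ Finset.range t, (B m).indicator (Y m) ω

/-- The exponential weight of an arm, whose expectation controls the deviations of `pullSum`. -/
noncomputable def expWeight (B : ℕ → Set Ω) (Y : ℕ → Ω → ℝ) (s θ : ℝ) (t : ℕ) (ω : Ω) : ℝ :=
  Real.exp (s * pullSum B Y t ω - θ * pullCount B t ω)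

/-- The arm is about to be pulled although the average of its rewards is at least `δ`. For centred
rewards this says that the sample mean is too high by `δ`. -/
def overestimatedPull (B : ℕ → Set Ω) (Y : ℕ → Ω → ℝ) (δ : ℝ) (t : ℕ) : Set Ω :=
  B t ∩ {ω | δ * pullCount B t ω ≤ pullSum B Y t ω}

/-- The arm has been pulled, and its average reward over `n` pulls is at most `-x / √n`. For centred
rewards this says that the mean lies above the confidence interval of radius `x / √n`. -/
def underestimated (B : ℕ → Set Ω) (Y : ℕ → Ω → ℝ) (x : ℝ) (t : ℕ) : Set Ω :=
  {ω | 0 < pullCount B t ω ∧ pullSum B Y t ω ≤ -(x * √(pullCount B t ω))}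

theorem pullCount_succ (B : ℕ → Set Ω) (t : ℕ) (ω : Ω) :
    pullCount B (t + 1) ω = pullCount B t ω + (B t).indicator 1 ω :=
  Finset.sum_range_succ _ _

theorem pullSum_succ (B : ℕ → Set Ω) (Y : ℕ → Ω → ℝ) (t : ℕ) (ω : Ω) :
    pullSum B Y (t + 1) ω = pullSum B Y t ω + (B t).indicator (Y t) ω :=
  Finset.sum_range_succ _ _

theorem pullCount_le (B : ℕ → Set Ω) (t : ℕ) (ω : Ω) : pullCount B t ω ≤ t := by
  refine (Finset.sum_le_card_nsmul _ _ 1 fun m _ => ?_).trans_eq (by simp)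
  exact Set.indicator_le_self' (fun _ _ => zero_le_one) ω

theorem sum_indicator_pullCount {R : Type*} [AddCommMonoid R] (B : ℕ → Set Ω) (f : ℕ → R) (t : ℕ)
    (ω : Ω) :
    ∑ m ∈ Finset.range t, (B m).indicator (fun ω => f (pullCount B m ω)) ω
      = ∑ k ∈ Finset.range (pullCount B t ω), f k := by
  induction t with
  | zero => simp [pullCount]
  | succ t ih =>
    rw [Finset.sum_range_succ, ih, pullCount_succ]
    by_cases h : ω ∈ B t <;> simp [h, Finset.sum_range_succ]

theorem expWeight_pos (B : ℕ → Set Ω) (Y : ℕ → Ω → ℝ) (s θ : ℝ) (t : ℕ) (ω : Ω) :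
    0 < expWeight B Y s θ t ω :=
  Real.exp_pos _

theorem expWeight_zero (B : ℕ → Set Ω) (Y : ℕ → Ω → ℝ) (s θ : ℝ) :
    expWeight B Y s θ 0 = fun _ => 1 := by
  funext ω
  simp [expWeight, pullSum, pullCount]

theorem expWeight_succ (B : ℕ → Set Ω) (Y : ℕ → Ω → ℝ) (s θ : ℝ) (t : ℕ) (ω : Ω) :
    expWeight B Y s θ (t + 1) ω = (B t)ᶜ.indicator (expWeight B Y s θ t) ω
      + Real.exp (-θ) * ((B t).indicator (expWeight B Y s θ t) ω * Real.exp (s * Y t ω)) := by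
  rw [expWeight, pullSum_succ, pullCount_succ]
  by_cases hB : ω ∈ B t
  · simp only [hB, Set.indicator_of_mem, Set.mem_compl_iff, not_true, not_false_eq_true,
      Set.indicator_of_notMem, expWeight, ← Real.exp_add, Pi.one_apply, zero_add]
    push_cast
    ring_nf
  · simp [expWeight, hB]

end SampledSums

section Arm

variable {Ω : Type*} [mΩ : MeasurableSpace Ω]

theorem measureReal_le_integral_of_one_le {P : Measure Ω} [IsFiniteMeasure P] {f : Ω → ℝ}
    (hf0 : 0 ≤ f) (hf : Integrable f P) {s : Set Ω} (hs : ∀ ω ∈ s, 1 ≤ f ω) :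
    P.real s ≤ ∫ ω, f ω ∂P := by
  have markov := mul_meas_ge_le_integral_of_nonneg (.of_forall hf0) hf 1
  rw [one_mul] at markov
  exact (measureReal_mono hs).trans markov

/-- An arm of a bandit. It is pulled at step `t` on the event `B t`, which is known before the step;
the (centred) reward `Y t` of the step is independent of the past and sub-Gaussian with variance
proxy `c`. -/
structure IsArm (P : Measure Ω) (ℱ : Filtration ℕ mΩ) (c : ℝ≥0) (B : ℕ → Set Ω)
    (Y : ℕ → Ω → ℝ) : Prop where
  pull : ∀ t, MeasurableSet[ℱ t] (B t)
  adapted : ∀ t, Measurable[ℱ (t + 1)] (Y t)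
  indep : ∀ t, Indep (MeasurableSpace.comap (Y t) inferInstance) (ℱ t) P
  subgaussian : ∀ t, HasSubgaussianMGF (Y t) c P

namespace IsArm

variable {P : Measure Ω} {ℱ : Filtration ℕ mΩ} {c : ℝ≥0} {B : ℕ → Set Ω} {Y : ℕ → Ω → ℝ}

theorem measurableSet_pull (h : IsArm P ℱ c B Y) (t : ℕ) : MeasurableSet (B t) :=
  ℱ.le t _ (h.pull t)

theorem measurable_pullCount (h : IsArm P ℱ c B Y) (t : ℕ) : Measurable[ℱ t] (pullCount B t) :=
  Finset.measurable_sum _ fun m hm =>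
    Measurable.indicator measurable_const (ℱ.mono (Finset.mem_range.1 hm).le _ (h.pull m))

theorem measurable_pullSum (h : IsArm P ℱ c B Y) (t : ℕ) : Measurable[ℱ t] (pullSum B Y t) :=
  Finset.measurable_sum _ fun m hm =>
    ((h.adapted m).mono (ℱ.mono (Finset.mem_range.1 hm)) le_rfl).indicator
      (ℱ.mono (Finset.mem_range.1 hm).le _ (h.pull m))

theorem measurable_expWeight (h : IsArm P ℱ c B Y) (s θ : ℝ) (t : ℕ) :
    Measurable[ℱ t] (expWeight B Y s θ t) :=
  Real.measurable_exp.comp (((h.measurable_pullSum t).const_mul s).sub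
    ((measurable_from_top.comp (h.measurable_pullCount t)).const_mul θ))

theorem measurableSet_overestimatedPull (h : IsArm P ℱ c B Y) (δ : ℝ) (t : ℕ) :
    MeasurableSet (overestimatedPull B Y δ t) := by
  have hcount := (h.measurable_pullCount t).mono (ℱ.le t) le_rfl
  have hsum := (h.measurable_pullSum t).mono (ℱ.le t) le_rfl
  exact (h.measurableSet_pull t).inter <| measurableSet_le
    ((measurable_from_top.comp hcount).const_mul δ) hsum

theorem measurableSet_underestimated (h : IsArm P ℱ c B Y) (x : ℝ) (t : ℕ) :
    MeasurableSet (underestimated B Y x t) := by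
  have hcount := (h.measurable_pullCount t).mono (ℱ.le t) le_rfl
  have hsum := (h.measurable_pullSum t).mono (ℱ.le t) le_rfl
  exact (measurableSet_lt measurable_const hcount).inter <| measurableSet_le hsum
    ((measurable_from_top.comp hcount).sqrt.const_mul x).neg

theorem indepFun_indicator_expWeight (h : IsArm P ℱ c B Y) (s θ : ℝ) (t : ℕ) :
    IndepFun ((B t).indicator (expWeight B Y s θ t)) (fun ω => Real.exp (s * Y t ω)) P := by
  rw [IndepFun_iff_Indep]
  refine (indep_of_indep_of_le_left (indep_of_indep_of_le_right (h.indep t) ?_) ?_).symm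
  · exact ((h.measurable_expWeight s θ t).indicator (h.pull t)).comap_le
  · exact (Real.measurable_exp.comp ((comap_measurable (Y t)).const_mul s)).comap_le

theorem integrable_expWeight [IsProbabilityMeasure P] (h : IsArm P ℱ c B Y) (s θ : ℝ) (t : ℕ) :
    Integrable (expWeight B Y s θ t) P := by
  induction t with
  | zero => exact expWeight_zero B Y s θ ▸ integrable_const 1
  | succ t ih =>
    have hpulled := (h.indepFun_indicator_expWeight s θ t).integrable_mul
      (ih.indicator (h.measurableSet_pull t)) ((h.subgaussian t).integrable_exp_mul s)
    rw [funext (expWeight_succ B Y s θ t)]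
    exact (ih.indicator (h.measurableSet_pull t).compl).add (hpulled.const_mul _)

theorem integrable_indicator_expWeight [IsProbabilityMeasure P] (h : IsArm P ℱ c B Y) (s θ : ℝ)
    (t : ℕ) : Integrable ((B t).indicator (expWeight B Y s θ t)) P :=
  (h.integrable_expWeight s θ t).indicator (h.measurableSet_pull t)

theorem integral_expWeight_succ_le [IsProbabilityMeasure P] (h : IsArm P ℱ c B Y) (s θ : ℝ)
    (t : ℕ) :
    ∫ ω, expWeight B Y s θ (t + 1) ω ∂P
      ≤ ∫ ω in (B t)ᶜ, expWeight B Y s θ t ω ∂P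
        + Real.exp (c * s ^ 2 / 2 - θ) * ∫ ω in B t, expWeight B Y s θ t ω ∂P := by
  have hB := h.measurableSet_pull t
  have hW := h.integrable_indicator_expWeight s θ t
  have hY := (h.subgaussian t).integrable_exp_mul s
  have hind := h.indepFun_indicator_expWeight s θ t
  have hprod : Integrable
      (fun ω => (B t).indicator (expWeight B Y s θ t) ω * Real.exp (s * Y t ω)) P :=
    hind.integrable_mul hW hY
  have hmgf : ∫ ω, Real.exp (s * Y t ω) ∂P ≤ Real.exp (c * s ^ 2 / 2) := (h.subgaussian t).mgf_le s
  have hnonneg : 0 ≤ ∫ ω in B t, expWeight B Y s θ t ω ∂P :=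
    integral_nonneg fun ω => (expWeight_pos ..).le
  calc ∫ ω, expWeight B Y s θ (t + 1) ω ∂P
      = ∫ ω in (B t)ᶜ, expWeight B Y s θ t ω ∂P + Real.exp (-θ) *
          ((∫ ω in B t, expWeight B Y s θ t ω ∂P) * ∫ ω, Real.exp (s * Y t ω) ∂P) := by
        simp_rw [expWeight_succ]
        rw [integral_add ((h.integrable_expWeight s θ t).indicator hB.compl) (hprod.const_mul _),
          integral_const_mul,
          hind.integral_fun_mul_eq_mul_integral hW.aestronglyMeasurable hY.aestronglyMeasurable,
          integral_indicator hB, integral_indicator hB.compl]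
    _ ≤ ∫ ω in (B t)ᶜ, expWeight B Y s θ t ω ∂P + Real.exp (-θ) *
          ((∫ ω in B t, expWeight B Y s θ t ω ∂P) * Real.exp (c * s ^ 2 / 2)) := by gcongr
    _ = _ := by rw [sub_eq_add_neg, Real.exp_add]; ring

theorem integral_expWeight_add_le_one [IsProbabilityMeasure P] (h : IsArm P ℱ c B Y) (s θ : ℝ)
    (t : ℕ) :
    ∫ ω, expWeight B Y s θ t ω ∂P + (1 - Real.exp (c * s ^ 2 / 2 - θ)) *
      ∑ m ∈ Finset.range t, ∫ ω in B m, expWeight B Y s θ m ω ∂P ≤ 1 := by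
  induction t with
  | zero => simp [expWeight_zero]
  | succ t ih =>
    have hstep := h.integral_expWeight_succ_le s θ t
    have hsplit := integral_add_compl (h.measurableSet_pull t) (h.integrable_expWeight s θ t)
    rw [Finset.sum_range_succ, mul_add]
    linarith

theorem sum_measureReal_overestimatedPull_le [IsProbabilityMeasure P] (h : IsArm P ℱ c B Y)
    (hc : 0 < c) {δ : ℝ} (hδ : 0 < δ) (t : ℕ) :
    ∑ m ∈ Finset.range t, P.real (overestimatedPull B Y δ m)
      ≤ 1 / (1 - Real.exp (-(δ ^ 2 / (2 * c)))) := by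
  have : (0 : ℝ) < c := hc
  -- The exponent `s * x - θ * n` is nonnegative where `δ * n ≤ x`, and `s = δ / c` makes the decay
  -- factor `exp (c * s ^ 2 / 2 - δ * s)` smallest.
  set s : ℝ := δ / c with hs
  set θ : ℝ := δ * s with hθ
  have hexponent : c * s ^ 2 / 2 - θ = -(δ ^ 2 / (2 * c)) := by
    rw [hθ, hs]; field_simp; ring
  have hlt : Real.exp (-(δ ^ 2 / (2 * c))) < 1 :=
    Real.exp_lt_one_iff.2 (neg_neg_of_pos (by positivity))
  have hle : ∀ m, P.real (overestimatedPull B Y δ m) ≤ ∫ ω in B m, expWeight B Y s θ m ω ∂P := by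
    intro m
    rw [← integral_indicator (h.measurableSet_pull m)]
    refine measureReal_le_integral_of_one_le
      (Set.indicator_nonneg fun ω _ => (expWeight_pos ..).le)
      (h.integrable_indicator_expWeight s θ m) fun ω hω => ?_
    rw [Set.indicator_of_mem hω.1, expWeight, hθ]
    have : s * (δ * pullCount B m ω) ≤ s * pullSum B Y m ω :=
      mul_le_mul_of_nonneg_left hω.2 (by positivity)
    exact Real.one_le_exp (by linarith)
  have hsum := h.integral_expWeight_add_le_one s θ t
  have hnonneg : 0 ≤ ∫ ω, expWeight B Y s θ t ω ∂P := integral_nonneg fun ω => (expWeight_pos ..).le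
  rw [hexponent] at hsum
  rw [le_div_iff₀' (by linarith)]
  calc (1 - Real.exp (-(δ ^ 2 / (2 * c)))) *
          ∑ m ∈ Finset.range t, P.real (overestimatedPull B Y δ m)
      ≤ (1 - Real.exp (-(δ ^ 2 / (2 * c)))) *
          ∑ m ∈ Finset.range t, ∫ ω in B m, expWeight B Y s θ m ω ∂P := by
        have := sub_nonneg.2 hlt.le
        gcongr with m
        exact hle m
    _ ≤ 1 := by linarith

theorem measureReal_pullCount_eq_and_pullSum_le [IsProbabilityMeasure P] (h : IsArm P ℱ c B Y)
    (hc : 0 < c) {n : ℕ} (hn : 0 < n) {x : ℝ} (hx : 0 ≤ x) (t : ℕ) :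
    P.real {ω | pullCount B t ω = n ∧ pullSum B Y t ω ≤ -(x * √n)}
      ≤ Real.exp (-(x ^ 2 / (2 * c))) := by
  have : (0 : ℝ) < c := hc
  have : 0 < √(n : ℝ) := Real.sqrt_pos.2 (by exact_mod_cast hn)
  -- This `s` minimizes `c * s ^ 2 / 2 * n + s * (x * √n)`.
  set s : ℝ := -(x / (c * √n)) with hs
  have hs_nonpos : s ≤ 0 := neg_nonpos.2 (by positivity)
  have hs_sqrt : s * √n = -(x / c) := by rw [hs]; field_simp
  have hexponent : s * -(x * √n) - c * s ^ 2 / 2 * n = x ^ 2 / (2 * c) := by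
    calc s * -(x * √n) - c * s ^ 2 / 2 * n
        = -x * (s * √n) - c / 2 * (s * √n) ^ 2 := by
          rw [mul_pow, Real.sq_sqrt n.cast_nonneg]; ring
      _ = x ^ 2 / (2 * c) := by rw [hs_sqrt]; field_simp; ring
  set θ : ℝ := c * s ^ 2 / 2 with hθ
  have hW : ∫ ω, expWeight B Y s θ t ω ∂P ≤ 1 := by
    have := h.integral_expWeight_add_le_one s θ t
    rwa [hθ, sub_self, Real.exp_zero, sub_self, zero_mul, add_zero] at this
  calc P.real {ω | pullCount B t ω = n ∧ pullSum B Y t ω ≤ -(x * √n)}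
      ≤ ∫ ω, Real.exp (-(x ^ 2 / (2 * c))) * expWeight B Y s θ t ω ∂P := by
        refine measureReal_le_integral_of_one_le
          (fun ω => mul_nonneg (Real.exp_pos _).le (expWeight_pos ..).le)
          ((h.integrable_expWeight s θ t).const_mul _) ?_
        rintro ω ⟨hcount, hsum⟩
        have := mul_le_mul_of_nonpos_left hsum hs_nonpos
        rw [expWeight, ← Real.exp_add, hcount]
        exact Real.one_le_exp (by linarith)
    _ ≤ Real.exp (-(x ^ 2 / (2 * c))) := by
        rw [integral_const_mul]
        exact mul_le_of_le_one_right (Real.exp_pos _).le hW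

theorem measureReal_underestimated_le [IsProbabilityMeasure P] (h : IsArm P ℱ c B Y) (hc : 0 < c)
    {x : ℝ} (hx : 0 ≤ x) (t : ℕ) :
    P.real (underestimated B Y x t) ≤ t * Real.exp (-(x ^ 2 / (2 * c))) := by
  have hsub : underestimated B Y x t ⊆ ⋃ n ∈ Finset.Icc 1 t,
      {ω | pullCount B t ω = n ∧ pullSum B Y t ω ≤ -(x * √n)} := fun ω hω =>
    Set.mem_iUnion₂.2 ⟨pullCount B t ω, Finset.mem_Icc.2 ⟨hω.1, pullCount_le B t ω⟩, rfl, hω.2⟩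
  calc P.real (underestimated B Y x t)
      ≤ ∑ n ∈ Finset.Icc 1 t, P.real {ω | pullCount B t ω = n ∧ pullSum B Y t ω ≤ -(x * √n)} :=
        (measureReal_mono hsub (measure_ne_top _ _)).trans (measureReal_biUnion_finset_le _ _)
    _ ≤ ∑ _n ∈ Finset.Icc 1 t, Real.exp (-(x ^ 2 / (2 * c))) := Finset.sum_le_sum fun n hn =>
        h.measureReal_pullCount_eq_and_pullSum_le hc (Finset.mem_Icc.1 hn).1 hx t
    _ = t * Real.exp (-(x ^ 2 / (2 * c))) := by simp

end IsArm

end Arm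

section TopOptions

variable {N K : ℕ} {m : Fin N → ℝ}

theorem mem_topOptions {j : Fin N} :
    j ∈ topOptions K m ↔ (Finset.univ.filter fun l => m j < m l).card < K := by
  simp [topOptions]

theorem card_topOptions (hm : Function.Injective m) (hKN : K ≤ N) :
    (topOptions K m).card = K := by
  have rank_lt (j : Fin N) : (Finset.univ.filter fun l => m j < m l).card < N :=
    (Finset.card_lt_univ_of_notMem (x := j) (by simp)).trans_eq (Fintype.card_fin N)
  let rank (j : Fin N) : Fin N := ⟨_, rank_lt j⟩
  have rank_anti {j l : Fin N} (hjl : m j < m l) : rank l < rank j := by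
    refine Fin.mk_lt_mk.2 <| Finset.card_lt_card <|
      (Finset.ssubset_iff_of_subset ?_).2 ⟨l, ?_, ?_⟩
    · exact Finset.monotone_filter_right _ fun _ _ h => hjl.trans h
    · simpa using hjl
    · simp
  have rank_injective : Function.Injective rank := by
    intro j l h
    by_contra hne
    rcases lt_or_gt_of_ne (hm.ne hne) with hlt | hlt
    · exact (rank_anti hlt).ne' h
    · exact (rank_anti hlt).ne h
  have himage : (topOptions K m).image rank = Finset.univ.filter fun k : Fin N => (k : ℕ) < K := by
    ext k
    obtain ⟨j, rfl⟩ := (Finite.injective_iff_surjective.1 rank_injective) k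
    simp [rank_injective.eq_iff, mem_topOptions, rank]
  rw [← Finset.card_image_of_injective _ rank_injective, himage, Fin.card_filter_val_lt,
    min_eq_right hKN]

theorem topOptions_nonempty [Nonempty (Fin N)] (hK : 1 ≤ K) : (topOptions K m).Nonempty := by
  obtain ⟨j, hj⟩ := Finite.exists_max m
  exact ⟨j, mem_topOptions.2 (by simpa [(hj _).not_gt] using Nat.lt_of_succ_le hK)⟩

theorem lt_of_mem_topOptions {j l : Fin N} (hl : l ∈ topOptions K m) (hj : j ∉ topOptions K m) :
    m j < m l := by
  contrapose! hj
  exact mem_topOptions.2 <| (Finset.card_le_card <|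
    Finset.monotone_filter_right _ fun _ _ h => hj.trans_lt h).trans_lt (mem_topOptions.1 hl)

theorem gap_le {l : Fin N} (hl : l ∈ topOptions K m) (j : Fin N) : gap K m j ≤ m l - m j :=
  sub_le_sub_right (csInf_le (Set.toFinite _).bddBelow (Set.mem_image_of_mem _ hl)) _

theorem gap_pos (hK : 1 ≤ K) {j : Fin N} (hj : j ∉ topOptions K m) : 0 < gap K m j := by
  have : Nonempty (Fin N) := ⟨j⟩
  obtain ⟨l, hl, hmin⟩ :=
    ((topOptions_nonempty hK).to_set.image m).csInf_mem (Set.toFinite (m '' topOptions K m))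
  rw [gap, ← hmin]
  exact sub_pos.2 (lt_of_mem_topOptions hl hj)

theorem sum_sub_sum_le_of_swap {ι G : Type*} [DecidableEq ι] [AddCommGroup G] [LinearOrder G]
    [IsOrderedAddMonoid G] {s t : Finset ι} (hcard : s.card = t.card) (f c : ι → G)
    (h : ∀ j ∈ s \ t, ∀ l ∈ t \ s, f l - f j ≤ c j) :
    ∑ l ∈ t, f l - ∑ j ∈ s, f j ≤ ∑ j ∈ s \ t, c j := by
  have hcard_sdiff : (s \ t).card = (t \ s).card := Finset.card_sdiff_comm hcard
  rw [← Finset.sum_sdiff_sub_sum_sdiff]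
  rcases (t \ s).eq_empty_or_nonempty with hempty | hne
  · have : s \ t = ∅ := by rw [← Finset.card_eq_zero, hcard_sdiff, hempty, Finset.card_empty]
    simp [hempty, this]
  · obtain ⟨l, hl, hmax⟩ := Finset.exists_max_image (t \ s) f hne
    calc ∑ x ∈ t \ s, f x - ∑ j ∈ s \ t, f j
        ≤ ∑ _j ∈ s \ t, f l - ∑ j ∈ s \ t, f j := by
          refine sub_le_sub_right ((Finset.sum_le_card_nsmul _ _ _ hmax).trans_eq ?_) _
          rw [Finset.sum_const, hcard_sdiff]
      _ = ∑ j ∈ s \ t, (f l - f j) := (Finset.sum_sub_distrib _ _).symm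
      _ ≤ ∑ j ∈ s \ t, c j := Finset.sum_le_sum fun j hj => h j hj l hl

end TopOptions

section PullCost

variable {r g : ℝ}

/-- A bound for the loss in a pull of an arm of gap `g` that has been pulled `n` times before, when
the loss is known to be at least `g` and, after the first pull, at most `r / √n`. -/
noncomputable def pullCost (r g : ℝ) (n : ℕ) : ℝ :=
  if n = 0 then 1 else if g ≤ r / √n then r / √n else 0

theorem pullCost_zero (r g : ℝ) : pullCost r g 0 = 1 :=
  if_pos rfl

theorem pullCost_nonneg (hr : 0 ≤ r) (g : ℝ) (n : ℕ) : 0 ≤ pullCost r g n := by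
  unfold pullCost
  split_ifs <;> positivity

theorem le_pullCost {D : ℝ} {n : ℕ} (hn : n ≠ 0) (hgD : g ≤ D) (hD : D ≤ r / √n) :
    D ≤ pullCost r g n := by
  rwa [pullCost, if_neg hn, if_pos (hgD.trans hD)]

theorem inv_sqrt_succ_le (n : ℕ) : (√(n + 1 : ℕ))⁻¹ ≤ 2 * (√(n + 1 : ℕ) - √n) := by
  have hpos : 0 < √((n + 1 : ℕ) : ℝ) := Real.sqrt_pos.2 (by positivity)
  have hsq : √((n + 1 : ℕ) : ℝ) ^ 2 = √(n : ℝ) ^ 2 + 1 := by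
    rw [Real.sq_sqrt (Nat.cast_nonneg _), Real.sq_sqrt n.cast_nonneg, Nat.cast_succ]
  rw [inv_le_iff_one_le_mul₀ hpos]
  linarith [sq_nonneg (√((n + 1 : ℕ) : ℝ) - √n)]

theorem sum_pullCost_succ_le (hr : 0 ≤ r) (hg : 0 < g) (n : ℕ) :
    ∑ k ∈ Finset.range (n + 1), pullCost r g k ≤ 1 + 2 * r * min √n (r / g) := by
  induction n with
  | zero => simp [pullCost_zero, min_eq_left (div_nonneg hr hg.le)]
  | succ n ih =>
    have hsqrt : 0 < √((n + 1 : ℕ) : ℝ) := Real.sqrt_pos.2 (by positivity)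
    have hmono : √(n : ℝ) ≤ √(n + 1 : ℕ) := Real.sqrt_le_sqrt (by simp)
    rw [Finset.sum_range_succ, pullCost, if_neg n.succ_ne_zero]
    split_ifs with hle
    · have hcut : √((n + 1 : ℕ) : ℝ) ≤ r / g := by
        rwa [le_div_iff₀ hg, mul_comm, ← le_div_iff₀ hsqrt]
      have hinv := mul_le_mul_of_nonneg_left (inv_sqrt_succ_le n) hr
      rw [min_eq_left hcut]
      rw [min_eq_left (hmono.trans hcut)] at ih
      rw [div_eq_mul_inv]
      linarith
    · rw [add_zero]
      exact ih.trans (by gcongr)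

theorem sum_pullCost_le (hr : 0 ≤ r) (hg : 0 < g) (n : ℕ) :
    ∑ k ∈ Finset.range n, pullCost r g k ≤ 1 + 2 * r ^ 2 / g := by
  cases n with
  | zero =>
    rw [Finset.sum_range_zero]
    positivity
  | succ n =>
    calc ∑ k ∈ Finset.range (n + 1), pullCost r g k
        ≤ 1 + 2 * r * min √n (r / g) := sum_pullCost_succ_le hr hg n
      _ ≤ 1 + 2 * r * (r / g) := by gcongr; exact min_le_right _ _
      _ = 1 + 2 * r ^ 2 / g := by ring

end PullCost

section Counts

variable {M N : ℕ} {Ω : Type*}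

/-- The event that user `i` chooses option `j` in step `t + 1`. -/
def pullEvent (a : ℕ → Fin M → Ω → Finset (Fin N)) (i : Fin M) (j : Fin N) (t : ℕ) : Set Ω :=
  {ω | j ∈ a (t + 1) i ω}

/-- The deviation from its mean of the reward of option `j` for user `i` in step `t + 1`. -/
def centredReward (μ : Fin M → Fin N → ℝ) (X : ℕ → Fin M → Fin N → Ω → ℝ) (i : Fin M) (j : Fin N)
    (t : ℕ) (ω : Ω) : ℝ :=
  X (t + 1) i j ω - μ i j

/-- The event that the indices of user `i` at time `t` cannot be trusted for the choice of
option `j`: the weight of the group frequencies exceeds `δ`, or the sample mean of `j` is too high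
by `δ`, or the mean of some option lies above its confidence interval. -/
def misleading (μ : Fin M → Fin N → ℝ) (α : ℝ) (X : ℕ → Fin M → Fin N → Ω → ℝ)
    (a : ℕ → Fin M → Ω → Finset (Fin N)) (i : Fin M) (j : Fin N) (δ : ℝ) (t : ℕ) : Set Ω :=
  {_ω | δ < |α| * √(Real.log t / t)} ∪
    (overestimatedPull (pullEvent a i j) (centredReward μ X i j) δ t ∪
      ⋃ l, underestimated (pullEvent a i l) (centredReward μ X i l) √(2 * Real.log t) t)

theorem sum_Icc_one_eq_sum_range {G : Type*} [AddCommMonoid G] (f : ℕ → G) (t : ℕ) :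
    ∑ m ∈ Finset.Icc 1 t, f m = ∑ m ∈ Finset.range t, f (m + 1) := by
  rw [Finset.range_eq_Ico, Finset.sum_Ico_add', zero_add, Finset.Ico_add_one_right_eq_Icc]

variable {μ : Fin M → Fin N → ℝ} {α : ℝ} {X : ℕ → Fin M → Fin N → Ω → ℝ}
  {a : ℕ → Fin M → Ω → Finset (Fin N)} {i : Fin M} {j l : Fin N} {δ : ℝ} {t : ℕ} {ω : Ω}

theorem sum_choice_eq (a : ℕ → Fin M → Ω → Finset (Fin N)) (i : Fin M) (t : ℕ)
    (f : Fin N → Ω → ℝ) (ω : Ω) :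
    ∑ j ∈ a (t + 1) i ω, f j ω = ∑ j, (pullEvent a i j t).indicator (f j) ω := by
  classical
  simp [pullEvent, Set.indicator_apply]

theorem userCount_eq_pullCount (a : ℕ → Fin M → Ω → Finset (Fin N)) (t : ℕ) (i : Fin M)
    (j : Fin N) : userCount a t i j = pullCount (pullEvent a i j) t := by
  classical
  funext ω
  rw [userCount, Finset.card_filter, sum_Icc_one_eq_sum_range]
  simp [pullCount, pullEvent, Set.indicator_apply]

theorem sum_reward_eq (μ : Fin M → Fin N → ℝ) (X : ℕ → Fin M → Fin N → Ω → ℝ)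
    (a : ℕ → Fin M → Ω → Finset (Fin N)) (t : ℕ) (i : Fin M) (j : Fin N) (ω : Ω) :
    ∑ m ∈ (Finset.Icc 1 t).filter (fun m => j ∈ a m i ω), X m i j ω
      = userCount a t i j ω * μ i j + pullSum (pullEvent a i j) (centredReward μ X i j) t ω := by
  classical
  have hsum : pullSum (pullEvent a i j) (centredReward μ X i j) t ω
      = ∑ m ∈ (Finset.Icc 1 t).filter (fun m => j ∈ a m i ω), (X m i j ω - μ i j) := by
    rw [Finset.sum_filter, sum_Icc_one_eq_sum_range]
    simp [pullSum, pullEvent, centredReward, Set.indicator_apply]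
  rw [hsum, Finset.sum_sub_distrib, Finset.sum_const, nsmul_eq_mul, userCount]
  ring

theorem sampleMean_eq (μ : Fin M → Fin N → ℝ) (hj : userCount a t i j ω ≠ 0) :
    sampleMean X a t i j ω
      = μ i j + pullSum (pullEvent a i j) (centredReward μ X i j) t ω / userCount a t i j ω := by
  have : (userCount a t i j ω : ℝ) ≠ 0 := Nat.cast_ne_zero.2 hj
  rw [sampleMean, sum_reward_eq μ]
  field_simp

theorem sampleMean_le (hj : userCount a t i j ω ≠ 0) (hpull : ω ∈ pullEvent a i j t)
    (h : ω ∉ overestimatedPull (pullEvent a i j) (centredReward μ X i j) δ t) :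
    sampleMean X a t i j ω ≤ μ i j + δ := by
  have hlt : pullSum (pullEvent a i j) (centredReward μ X i j) t ω < δ * userCount a t i j ω := by
    rw [userCount_eq_pullCount]
    exact not_le.1 fun hle => h ⟨hpull, hle⟩
  rw [sampleMean_eq μ hj]
  gcongr
  exact (div_le_iff₀ (by positivity)).2 hlt.le

theorem le_sampleMean_add (hj : userCount a t i j ω ≠ 0)
    (h : ω ∉ underestimated (pullEvent a i j) (centredReward μ X i j) √(2 * Real.log t) t) :
    μ i j ≤ sampleMean X a t i j ω + √(2 * Real.log t / userCount a t i j ω) := by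
  set n := userCount a t i j ω with hn
  set S := pullSum (pullEvent a i j) (centredReward μ X i j) t ω
  have hn_pos : (0 : ℝ) < n := by positivity
  have hlt : -(√(2 * Real.log t) * √n) < S := by
    rw [hn, userCount_eq_pullCount] at hj ⊢
    exact not_le.1 fun hle => h ⟨Nat.pos_of_ne_zero hj, hle⟩
  have hradius : √(2 * Real.log t / n) = √(2 * Real.log t) * √n / n := by
    rw [Real.sqrt_div' _ hn_pos.le, mul_div_assoc, Real.sqrt_div_self', mul_one_div]
  rw [sampleMean_eq μ hj, hradius, add_assoc, ← add_div]
  exact le_add_of_nonneg_right (div_nonneg (by linarith) hn_pos.le)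

theorem groupFreq_mem_Icc (a : ℕ → Fin M → Ω → Finset (Fin N)) (t : ℕ) (j : Fin N) (ω : Ω) :
    groupFreq a t j ω ∈ Set.Icc (0 : ℝ) 1 :=
  ⟨by unfold groupFreq; positivity, div_le_one_of_le₀
    (Finset.single_le_sum (f := fun l => (groupCount a t l ω : ℝ)) (fun _ _ => by positivity)
      (Finset.mem_univ j)) (by positivity)⟩

theorem mul_groupFreq_sub_le (α : ℝ) (a : ℕ → Fin M → Ω → Finset (Fin N)) (t : ℕ) (j l : Fin N)
    (ω : Ω) : α * (groupFreq a t j ω - groupFreq a t l ω) ≤ |α| := by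
  obtain ⟨hj0, hj1⟩ := groupFreq_mem_Icc a t j ω
  obtain ⟨hl0, hl1⟩ := groupFreq_mem_Icc a t l ω
  calc α * (groupFreq a t j ω - groupFreq a t l ω)
      ≤ |α| * |groupFreq a t j ω - groupFreq a t l ω| := (le_abs_self _).trans_eq (abs_mul _ _)
    _ ≤ |α| := mul_le_of_le_one_right (abs_nonneg α) (abs_le.2 ⟨by linarith, by linarith⟩)

theorem upartIndex_of_ne_zero (hj : userCount a t i j ω ≠ 0) :
    upartIndex α X a t i j ω = ((sampleMean X a t i j ω
      - α * (1 - groupFreq a t j ω) * √(Real.log t / t)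
      + √(2 * Real.log t / userCount a t i j ω) : ℝ) : EReal) :=
  if_neg hj

theorem userCount_ne_zero_of_upartIndex_le (hj : userCount a t i j ω ≠ 0)
    (hindex : upartIndex α X a t i l ω ≤ upartIndex α X a t i j ω) : userCount a t i l ω ≠ 0 := by
  intro hl
  rw [upartIndex_of_ne_zero hj, upartIndex, if_pos hl] at hindex
  exact (EReal.coe_lt_top _).not_ge hindex

theorem sub_le_of_upartIndex_le (hj : userCount a t i j ω ≠ 0) (hpull : ω ∈ pullEvent a i j t)
    (hindex : upartIndex α X a t i l ω ≤ upartIndex α X a t i j ω)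
    (h : ω ∉ misleading μ α X a i j δ t) :
    μ i l - μ i j ≤ 2 * δ + √(2 * Real.log t / userCount a t i j ω) := by
  simp only [misleading, Set.mem_union, Set.mem_iUnion, not_or, not_exists] at h
  obtain ⟨hpenalty, hover, hunder⟩ := h
  have hl := userCount_ne_zero_of_upartIndex_le hj hindex
  have hmean_l := le_sampleMean_add hl (hunder l)
  have hmean_j := sampleMean_le hj hpull hover
  have hpenalty : |α| * √(Real.log t / t) ≤ δ := not_lt.1 hpenalty
  have hgroup := mul_le_mul_of_nonneg_right (mul_groupFreq_sub_le α a t j l ω)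
    (Real.sqrt_nonneg (Real.log t / t))
  rw [upartIndex_of_ne_zero hl, upartIndex_of_ne_zero hj, EReal.coe_le_coe_iff] at hindex
  linarith

theorem sub_le_pullCost {κ g : ℝ} {T : ℕ} (hκ : 0 < κ) (hκ1 : κ ≤ 1) (htT : t ≤ T)
    (hgap : g ≤ μ i l - μ i j) (hle_one : μ i l - μ i j ≤ 1) (hpull : ω ∈ pullEvent a i j t)
    (hindex : upartIndex α X a t i l ω ≤ upartIndex α X a t i j ω)
    (h : ω ∉ misleading μ α X a i j ((1 - κ) * g / 2) t) :
    μ i l - μ i j ≤ pullCost (√(2 * Real.log T) / κ) g (userCount a t i j ω) := by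
  by_cases hj : userCount a t i j ω = 0
  · rwa [hj, pullCost_zero]
  refine le_pullCost hj hgap ?_
  have hlog : Real.log t ≤ Real.log T := by
    rcases t.eq_zero_or_pos with rfl | ht
    · simpa using Real.log_natCast_nonneg T
    · gcongr
  have hradius : √(2 * Real.log t / userCount a t i j ω)
      ≤ √(2 * Real.log T) / √(userCount a t i j ω) := by
    rw [Real.sqrt_div' _ (Nat.cast_nonneg _)]
    gcongr
  have hsub := sub_le_of_upartIndex_le hj hpull hindex h
  have hgap_mul := mul_le_mul_of_nonneg_left hgap (sub_nonneg.2 hκ1)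
  rw [div_right_comm, le_div_iff₀' hκ]
  linarith

theorem sum_sub_sum_choice_le {S : Finset (Fin N)} {f : Fin N → ℝ} {cost err : Fin N → ℕ → ℝ}
    {T : ℕ} (hcard : ∀ t, (a (t + 1) i ω).card = S.card) (hcost : ∀ j k, 0 ≤ cost j k)
    (herr : ∀ j t, 0 ≤ err j t)
    (hswap : ∀ t < T, ∀ j ∈ a (t + 1) i ω \ S, ∀ l ∈ S \ a (t + 1) i ω,
      f l - f j ≤ cost j (userCount a t i j ω) + err j t) :
    ∑ t ∈ Finset.range T, (∑ j ∈ S, f j - ∑ j ∈ a (t + 1) i ω, f j)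
      ≤ ∑ j ∈ Sᶜ, (∑ k ∈ Finset.range (userCount a T i j ω), cost j k
        + ∑ t ∈ Finset.range T, err j t) := by
  have hstep (t : ℕ) (ht : t ∈ Finset.range T) : ∑ j ∈ S, f j - ∑ j ∈ a (t + 1) i ω, f j
      ≤ ∑ j ∈ Sᶜ, ((pullEvent a i j t).indicator
        (fun ω => cost j (pullCount (pullEvent a i j) t ω)) ω + err j t) := by
    refine (sum_sub_sum_le_of_swap (hcard t) f _ (hswap t (Finset.mem_range.1 ht))).trans ?_
    calc ∑ j ∈ a (t + 1) i ω \ S, (cost j (userCount a t i j ω) + err j t)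
        = ∑ j ∈ a (t + 1) i ω \ S, ((pullEvent a i j t).indicator
            (fun ω => cost j (pullCount (pullEvent a i j) t ω)) ω + err j t) := by
          refine Finset.sum_congr rfl fun j hj => ?_
          rw [Set.indicator_of_mem (show ω ∈ pullEvent a i j t from (Finset.mem_sdiff.1 hj).1),
            userCount_eq_pullCount]
      _ ≤ _ := Finset.sum_le_sum_of_subset_of_nonneg
          (fun j hj => Finset.mem_compl.2 (Finset.mem_sdiff.1 hj).2) fun j _ _ =>
          add_nonneg (Set.indicator_nonneg (fun _ _ => hcost j _) ω) (herr j t)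
  refine (Finset.sum_le_sum hstep).trans_eq ?_
  rw [Finset.sum_comm]
  simp only [Finset.sum_add_distrib, sum_indicator_pullCount, userCount_eq_pullCount]

end Counts

section Regret

variable {M N K : ℕ} {Ω : Type*} [mΩ : MeasurableSpace Ω] {P : Measure Ω} {ℱ : Filtration ℕ mΩ}
  {μ : Fin M → Fin N → ℝ} {α : ℝ} {X : ℕ → Fin M → Fin N → Ω → ℝ}
  {a : ℕ → Fin M → Ω → Finset (Fin N)} {i : Fin M}

/-- User `i` follows U_PART with weight `α`, whatever the other users do. -/
structure FollowsUPart (ℱ : Filtration ℕ mΩ) (K : ℕ) (α : ℝ) (X : ℕ → Fin M → Fin N → Ω → ℝ)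
    (a : ℕ → Fin M → Ω → Finset (Fin N)) (i : Fin M) : Prop where
  predictable : ∀ j t, MeasurableSet[ℱ t] (pullEvent a i j t)
  card_eq : ∀ t ω, (a (t + 1) i ω).card = K
  highest : ∀ t ω, ∀ j ∈ a (t + 1) i ω, ∀ l ∉ a (t + 1) i ω,
    upartIndex α X a t i l ω ≤ upartIndex α X a t i j ω

theorem IsUPart.followsUPart (ha : IsUPart ℱ K α X a) (i : Fin M) : FollowsUPart ℱ K α X a i where
  predictable j t := ha.predictable t i j
  card_eq t := ha.card_eq t i
  highest t := ha.highest t i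

namespace IsRewardProcess

theorem measurable (hX : IsRewardProcess P ℱ μ X) (t : ℕ) (i : Fin M) (j : Fin N) :
    Measurable (X (t + 1) i j) :=
  (hX.adapted (t + 1) t.succ_pos i j).mono (ℱ.le _) le_rfl

theorem indep_comap (hX : IsRewardProcess P ℱ μ X) (t : ℕ) (i : Fin M) (j : Fin N) :
    Indep (MeasurableSpace.comap (X (t + 1) i j) inferInstance) (ℱ t) P := by
  have hcoord : Measurable[MeasurableSpace.comap
      (fun ω (i : Fin M) (j : Fin N) => X (t + 1) i j ω) inferInstance] (X (t + 1) i j) :=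
    (measurable_pi_apply (X := fun _ : Fin N => ℝ) j).comp
      ((measurable_pi_apply (X := fun _ : Fin M => Fin N → ℝ) i).comp (comap_measurable _))
  exact indep_of_indep_of_le_left (hX.indep_past t) hcoord.comap_le

theorem setIntegral_eq (hX : IsRewardProcess P ℱ μ X) (t : ℕ) (i : Fin M) (j : Fin N) {B : Set Ω}
    (hB : MeasurableSet[ℱ t] B) : ∫ ω in B, X (t + 1) i j ω ∂P = P.real B * μ i j := by
  have hB' : MeasurableSet B := ℱ.le t B hB
  have hindep : IndepFun (B.indicator (fun _ => (1 : ℝ))) (X (t + 1) i j) P := by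
    rw [IndepFun_iff_Indep]
    exact (indep_of_indep_of_le_right (hX.indep_comap t i j)
      (Measurable.indicator measurable_const hB).comap_le).symm
  calc ∫ ω in B, X (t + 1) i j ω ∂P
      = ∫ ω, B.indicator (fun _ => (1 : ℝ)) ω * X (t + 1) i j ω ∂P := by
        rw [← integral_indicator hB']
        congr with ω
        by_cases hω : ω ∈ B <;> simp [hω]
    _ = P.real B * μ i j := by
        rw [hindep.integral_fun_mul_eq_mul_integral
          (measurable_const.indicator hB').aestronglyMeasurable
          (hX.measurable t i j).aestronglyMeasurable, hX.mean (t + 1) t.succ_pos,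
          integral_indicator_const _ hB', smul_eq_mul, mul_one]

variable [IsProbabilityMeasure P]

theorem integrable (hX : IsRewardProcess P ℱ μ X) (t : ℕ) (i : Fin M) (j : Fin N) :
    Integrable (X (t + 1) i j) P :=
  .of_mem_Icc 0 1 (hX.measurable t i j).aemeasurable (hX.mem_unit (t + 1) t.succ_pos i j)

theorem mean_mem_Icc (hX : IsRewardProcess P ℱ μ X) (i : Fin M) (j : Fin N) :
    μ i j ∈ Set.Icc (0 : ℝ) 1 := by
  rw [← hX.mean 1 le_rfl i j]
  exact (convex_Icc (0 : ℝ) 1).integral_mem isClosed_Icc (hX.mem_unit 1 le_rfl i j)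
    (hX.integrable 0 i j)

theorem isArm (hX : IsRewardProcess P ℱ μ X) {j : Fin N}
    (ha : ∀ t, MeasurableSet[ℱ t] (pullEvent a i j t)) :
    IsArm P ℱ (1 / 4) (pullEvent a i j) (centredReward μ X i j) where
  pull := ha
  adapted t := (hX.adapted (t + 1) t.succ_pos i j).sub_const _
  indep t := indep_of_indep_of_le_left (hX.indep_comap t i j)
    (Measurable.sub_const (comap_measurable (X (t + 1) i j)) (μ i j)).comap_le
  subgaussian t := by
    have hoeffding := hasSubgaussianMGF_of_mem_Icc (hX.measurable t i j).aemeasurable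
      (hX.mem_unit (t + 1) t.succ_pos i j)
    have hproxy : (‖(1 : ℝ) - 0‖₊ / 2) ^ 2 = 1 / 4 := by
      ext
      norm_num
    rwa [hX.mean (t + 1) t.succ_pos i j, hproxy] at hoeffding

end IsRewardProcess

theorem measurableSet_misleading {c : ℝ≥0}
    (h : ∀ j, IsArm P ℱ c (pullEvent a i j) (centredReward μ X i j)) (j : Fin N) (δ : ℝ) (t : ℕ) :
    MeasurableSet (misleading μ α X a i j δ t) :=
  (MeasurableSet.const _).union <| ((h j).measurableSet_overestimatedPull δ t).union <|
    .iUnion fun l => (h l).measurableSet_underestimated _ t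

variable [IsProbabilityMeasure P]

theorem integrable_sum_mean_choice (ha : ∀ j t, MeasurableSet (pullEvent a i j t)) (t : ℕ) :
    Integrable (fun ω => ∑ j ∈ a (t + 1) i ω, μ i j) P := by
  simp only [sum_choice_eq a i t (fun j _ => μ i j)]
  exact integrable_finsetSum _ fun j _ => (integrable_const _).indicator (ha j t)

theorem integrable_sum_reward_choice (hX : IsRewardProcess P ℱ μ X)
    (ha : ∀ j t, MeasurableSet (pullEvent a i j t)) (t : ℕ) :
    Integrable (fun ω => ∑ j ∈ a (t + 1) i ω, X (t + 1) i j ω) P := by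
  simp only [sum_choice_eq a i t (X (t + 1) i)]
  exact integrable_finsetSum _ fun j _ => (hX.integrable t i j).indicator (ha j t)

theorem integral_sum_reward_choice (hX : IsRewardProcess P ℱ μ X)
    (ha : ∀ j t, MeasurableSet[ℱ t] (pullEvent a i j t)) (t : ℕ) :
    ∫ ω, ∑ j ∈ a (t + 1) i ω, X (t + 1) i j ω ∂P = ∫ ω, ∑ j ∈ a (t + 1) i ω, μ i j ∂P := by
  have hpull (j : Fin N) : MeasurableSet (pullEvent a i j t) := ℱ.le t _ (ha j t)
  simp only [sum_choice_eq a i t (X (t + 1) i), sum_choice_eq a i t (fun j _ => μ i j)]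
  rw [integral_finsetSum _ fun j _ => (hX.integrable t i j).indicator (hpull j),
    integral_finsetSum _ fun j _ => (integrable_const _).indicator (hpull j)]
  refine Finset.sum_congr rfl fun j _ => ?_
  rw [integral_indicator (hpull j), hX.setIntegral_eq t i j (ha j t),
    integral_indicator_const _ (hpull j), smul_eq_mul]

theorem integrable_sum_meanRegret (ha : ∀ j t, MeasurableSet (pullEvent a i j t)) (T : ℕ) :
    Integrable (fun ω => ∑ t ∈ Finset.range T,
      (∑ j ∈ topOptions K (μ i), μ i j - ∑ j ∈ a (t + 1) i ω, μ i j)) P :=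
  integrable_finsetSum _ fun t _ => (integrable_const _).sub (integrable_sum_mean_choice ha t)

theorem weakRegret_eq (hX : IsRewardProcess P ℱ μ X)
    (ha : ∀ j t, MeasurableSet[ℱ t] (pullEvent a i j t)) (T : ℕ) :
    weakRegret P K μ X a i T = ∫ ω, ∑ t ∈ Finset.range T,
      (∑ j ∈ topOptions K (μ i), μ i j - ∑ j ∈ a (t + 1) i ω, μ i j) ∂P := by
  have ha' (j : Fin N) (t : ℕ) : MeasurableSet (pullEvent a i j t) := ℱ.le t _ (ha j t)
  have hmean (t : ℕ) := integrable_sum_mean_choice (P := P) (μ := μ) ha' t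
  have hsum : Integrable (fun ω => ∑ t ∈ Finset.range T, ∑ j ∈ a (t + 1) i ω, μ i j) P :=
    integrable_finsetSum _ fun t _ => hmean t
  simp only [weakRegret, sum_Icc_one_eq_sum_range, Finset.sum_sub_distrib]
  rw [integral_sub (integrable_const _) hsum, integral_finsetSum _ fun t _ => hmean t,
    integral_finsetSum _ fun t _ => integrable_sum_reward_choice hX ha' t]
  simp [integral_sum_reward_choice hX ha]

theorem FollowsUPart.sum_meanRegret_le (ha : FollowsUPart ℱ K α X a i) (hK : 1 ≤ K) (hKN : K ≤ N)
    (hinj : Function.Injective (μ i)) (hμ : ∀ j, μ i j ∈ Set.Icc (0 : ℝ) 1) {κ : ℝ} (hκ : 0 < κ)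
    (hκ1 : κ ≤ 1) (T : ℕ) (ω : Ω) :
    ∑ t ∈ Finset.range T, (∑ j ∈ topOptions K (μ i), μ i j - ∑ j ∈ a (t + 1) i ω, μ i j)
      ≤ ∑ j ∈ (topOptions K (μ i))ᶜ, (4 / κ ^ 2 * Real.log T / gap K (μ i) j + 1
        + ∑ t ∈ Finset.range T,
          (misleading μ α X a i j ((1 - κ) * gap K (μ i) j / 2) t).indicator 1 ω) := by
  let r : ℝ := √(2 * Real.log T) / κ
  have hr : 0 ≤ r := by positivity
  have hr_sq : 2 * r ^ 2 = 4 / κ ^ 2 * Real.log T := by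
    rw [div_pow, Real.sq_sqrt (mul_nonneg zero_le_two (Real.log_natCast_nonneg T))]
    ring
  let cost (j : Fin N) : ℕ → ℝ := pullCost r (gap K (μ i) j)
  let err (j : Fin N) (t : ℕ) : ℝ :=
    (misleading μ α X a i j ((1 - κ) * gap K (μ i) j / 2) t).indicator 1 ω
  have hcost (j : Fin N) (k : ℕ) : 0 ≤ cost j k := pullCost_nonneg hr _ k
  have herr (j : Fin N) (t : ℕ) : 0 ≤ err j t := Set.indicator_nonneg (fun _ _ => zero_le_one) ω
  refine (sum_sub_sum_choice_le (cost := cost) (err := err)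
    (fun t => (ha.card_eq t ω).trans (card_topOptions hinj hKN).symm) hcost herr ?_).trans
    (Finset.sum_le_sum fun j hj => ?_)
  · intro t ht j hj l hl
    obtain ⟨hj, -⟩ := Finset.mem_sdiff.1 hj
    obtain ⟨hl_top, hl⟩ := Finset.mem_sdiff.1 hl
    have hle_one : μ i l - μ i j ≤ 1 := by linarith [(hμ l).2, (hμ j).1]
    by_cases h : ω ∈ misleading μ α X a i j ((1 - κ) * gap K (μ i) j / 2) t
    · have : err j t = 1 := Set.indicator_of_mem h 1
      linarith [hcost j (userCount a t i j ω)]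
    · exact (sub_le_pullCost hκ hκ1 ht.le (gap_le hl_top j) hle_one hj (ha.highest t ω j hj l hl)
        h).trans (le_add_of_nonneg_right (herr j t))
  · have hsum := sum_pullCost_le hr (gap_pos hK (Finset.mem_compl.1 hj)) (userCount a T i j ω)
    rw [hr_sq] at hsum
    linarith

theorem sum_range_le_natCast {R : Type*} [Semiring R] [PartialOrder R] [IsOrderedRing R]
    {f : ℕ → R} {t₀ : ℕ} (hone : ∀ t, f t ≤ 1) (hzero : ∀ t, t₀ ≤ t → f t ≤ 0) (T : ℕ) :
    ∑ t ∈ Finset.range T, f t ≤ t₀ := by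
  calc ∑ t ∈ Finset.range T, f t
      ≤ ∑ t ∈ Finset.range T, if t < t₀ then 1 else 0 := by
        refine Finset.sum_le_sum fun t _ => ?_
        split_ifs with ht
        · exact hone t
        · exact hzero t (not_lt.1 ht)
    _ ≤ t₀ := by
        rw [← Finset.sum_filter, Finset.sum_const, nsmul_one]
        exact Nat.mono_cast <| (Finset.card_le_card fun t ht =>
          Finset.mem_range.2 (Finset.mem_filter.1 ht).2).trans_eq (Finset.card_range t₀)

theorem IsArm.measureReal_underestimated_sqrt_log_le {B : ℕ → Set Ω} {Y : ℕ → Ω → ℝ}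
    (h : IsArm P ℱ (1 / 4) B Y) (t : ℕ) :
    P.real (underestimated B Y √(2 * Real.log t) t) ≤ 1 / (t : ℝ) ^ 3 := by
  refine (h.measureReal_underestimated_le (by norm_num) (Real.sqrt_nonneg _) t).trans_eq ?_
  rcases t.eq_zero_or_pos with rfl | ht
  · simp
  have ht : (0 : ℝ) < t := Nat.cast_pos.2 ht
  have hexponent : -(√(2 * Real.log t) ^ 2 / (2 * ((1 / 4 : ℝ≥0) : ℝ))) = -(4 * Real.log t) := by
    rw [Real.sq_sqrt (mul_nonneg zero_le_two (Real.log_natCast_nonneg t))]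
    push_cast
    ring
  have hexp : Real.exp (4 * Real.log t) = (t : ℝ) ^ 4 := by
    rw [← Nat.cast_ofNat, Real.exp_nat_mul, Real.exp_log ht]
  rw [hexponent, Real.exp_neg, hexp]
  field_simp

/-- A bound for the expected number of misleading steps for an option, when the weight of the group
frequencies is at most `δ` from time `t₀` on. -/
noncomputable def misleadingBound (N : ℕ) (δ : ℝ) (t₀ : ℕ) : ℝ :=
  t₀ + (1 / (1 - Real.exp (-(2 * δ ^ 2))) + N * ∑' t : ℕ, 1 / (t : ℝ) ^ 3)

theorem sum_measureReal_misleading_le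
    (h : ∀ j, IsArm P ℱ (1 / 4) (pullEvent a i j) (centredReward μ X i j)) (j : Fin N) {δ : ℝ}
    (hδ : 0 < δ) {t₀ : ℕ} (ht₀ : ∀ t : ℕ, t₀ ≤ t → |α| * √(Real.log t / t) ≤ δ) (T : ℕ) :
    ∑ t ∈ Finset.range T, P.real (misleading μ α X a i j δ t) ≤ misleadingBound N δ t₀ := by
  have hearly : ∑ t ∈ Finset.range T, P.real {_ω : Ω | δ < |α| * √(Real.log t / t)} ≤ t₀ := by
    refine sum_range_le_natCast (fun t => measureReal_le_one) (fun t ht => ?_) T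
    have hempty : {_ω : Ω | δ < |α| * √(Real.log t / t)} = ∅ :=
      Set.eq_empty_of_forall_notMem fun _ => (ht₀ t ht).not_gt
    rw [hempty, measureReal_empty]
  have hover : ∑ t ∈ Finset.range T,
      P.real (overestimatedPull (pullEvent a i j) (centredReward μ X i j) δ t)
        ≤ 1 / (1 - Real.exp (-(2 * δ ^ 2))) := by
    refine ((h j).sum_measureReal_overestimatedPull_le (by norm_num) hδ T).trans_eq ?_
    have : δ ^ 2 / (2 * ((1 / 4 : ℝ≥0) : ℝ)) = 2 * δ ^ 2 := by
      push_cast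
      ring
    rw [this]
  have hunder (l : Fin N) : ∑ t ∈ Finset.range T,
      P.real (underestimated (pullEvent a i l) (centredReward μ X i l) √(2 * Real.log t) t)
        ≤ ∑' t : ℕ, 1 / (t : ℝ) ^ 3 :=
    (Finset.sum_le_sum fun t _ => (h l).measureReal_underestimated_sqrt_log_le t).trans <|
      (Real.summable_one_div_nat_pow.2 (by norm_num)).sum_le_tsum _ fun t _ => by positivity
  calc ∑ t ∈ Finset.range T, P.real (misleading μ α X a i j δ t)
      ≤ ∑ t ∈ Finset.range T, (P.real {_ω : Ω | δ < |α| * √(Real.log t / t)}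
          + (P.real (overestimatedPull (pullEvent a i j) (centredReward μ X i j) δ t)
            + ∑ l, P.real (underestimated (pullEvent a i l) (centredReward μ X i l)
              √(2 * Real.log t) t))) := Finset.sum_le_sum fun t _ =>
        (measureReal_union_le _ _).trans <| add_le_add_right ((measureReal_union_le _ _).trans <|
          add_le_add_right (measureReal_iUnion_fintype_le _) _) _
    _ ≤ misleadingBound N δ t₀ := by
        rw [Finset.sum_add_distrib, Finset.sum_add_distrib, Finset.sum_comm]
        refine add_le_add hearly (add_le_add hover ?_)
        exact (Finset.sum_le_card_nsmul _ _ _ fun l _ => hunder l).trans_eq (by simp)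

theorem FollowsUPart.weakRegret_le (ha : FollowsUPart ℱ K α X a i) (hK : 1 ≤ K)
    (hX : IsRewardProcess P ℱ μ X) (hinj : Function.Injective (μ i)) {κ : ℝ} (hκ : 0 < κ)
    (hκ1 : κ < 1) {t₀ : ℕ} (ht₀ : ∀ t : ℕ, t₀ ≤ t → ∀ j ∉ topOptions K (μ i),
      |α| * √(Real.log t / t) ≤ (1 - κ) * gap K (μ i) j / 2) (T : ℕ) :
    weakRegret P K μ X a i T
      ≤ ∑ j ∈ (topOptions K (μ i))ᶜ, 4 / κ ^ 2 * Real.log T / gap K (μ i) j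
        + ∑ j ∈ (topOptions K (μ i))ᶜ,
          (1 + misleadingBound N ((1 - κ) * gap K (μ i) j / 2) t₀) := by
  have harm (j : Fin N) := hX.isArm (ha.predictable j)
  have hpull (j : Fin N) (t : ℕ) : MeasurableSet (pullEvent a i j t) :=
    ℱ.le t _ (ha.predictable j t)
  have hKN : K ≤ N := by
    obtain ⟨ω⟩ := P.nonempty_of_neZero
    exact (ha.card_eq 0 ω).symm.trans_le (card_finset_fin_le _)
  set δ : Fin N → ℝ := fun j => (1 - κ) * gap K (μ i) j / 2
  have hδ {j : Fin N} (hj : j ∉ topOptions K (μ i)) : 0 < δ j :=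
    half_pos (mul_pos (sub_pos.2 hκ1) (gap_pos hK hj))
  have hmis (j : Fin N) (t : ℕ) := measurableSet_misleading (α := α) harm j (δ j) t
  have hint (j : Fin N) (t : ℕ) :
      Integrable ((misleading μ α X a i j (δ j) t).indicator (1 : Ω → ℝ)) P :=
    (integrable_const 1).indicator (hmis j t)
  have hint_sum (j : Fin N) := integrable_finsetSum (Finset.range T) fun t _ => hint j t
  have hint_cost (j : Fin N) : Integrable (fun ω => 4 / κ ^ 2 * Real.log T / gap K (μ i) j + 1
      + ∑ t ∈ Finset.range T, (misleading μ α X a i j (δ j) t).indicator 1 ω) P :=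
    (integrable_const _).add (hint_sum j)
  calc weakRegret P K μ X a i T
      ≤ ∫ ω, ∑ j ∈ (topOptions K (μ i))ᶜ, (4 / κ ^ 2 * Real.log T / gap K (μ i) j + 1
          + ∑ t ∈ Finset.range T, (misleading μ α X a i j (δ j) t).indicator 1 ω) ∂P := by
        rw [weakRegret_eq hX ha.predictable]
        exact integral_mono (integrable_sum_meanRegret hpull T)
          (integrable_finsetSum _ fun j _ => hint_cost j)
          (ha.sum_meanRegret_le hK hKN hinj (hX.mean_mem_Icc i) hκ hκ1.le T)
    _ = ∑ j ∈ (topOptions K (μ i))ᶜ, (4 / κ ^ 2 * Real.log T / gap K (μ i) j + 1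
          + ∑ t ∈ Finset.range T, P.real (misleading μ α X a i j (δ j) t)) := by
        rw [integral_finsetSum _ fun j _ => hint_cost j]
        refine Finset.sum_congr rfl fun j _ => ?_
        rw [integral_add (integrable_const _) (hint_sum j),
          integral_finsetSum _ fun t _ => hint j t]
        simp [integral_indicator_one (hmis _ _)]
    _ ≤ _ := by
        simp only [add_assoc, ← Finset.sum_add_distrib]
        refine Finset.sum_le_sum fun j hj => ?_
        have hj := Finset.mem_compl.1 hj
        gcongr
        exact sum_measureReal_misleading_le harm j (hδ hj) (fun t ht => ht₀ t ht j hj) T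

theorem tendsto_mul_sqrt_log_div (c : ℝ) :
    Tendsto (fun t : ℕ => c * √(Real.log t / t)) atTop (𝓝 0) := by
  have hlog : Tendsto (fun t : ℕ => Real.log t / t) atTop (𝓝 0) :=
    Real.isLittleO_log_id_atTop.tendsto_div_nhds_zero.comp tendsto_natCast_atTop_atTop
  simpa using hlog.sqrt.const_mul c

end Regret

end GroupLearning

open GroupLearning in
theorem mainTheorem2_general {M N K : ℕ} (hK : 1 ≤ K) (μ : Fin M → Fin N → ℝ) (α : ℝ) {c : ℝ}
    (hc : 4 < c) :
    ∃ C : ℝ, ∀ {Ω : Type*} [mΩ : MeasurableSpace Ω] (P : Measure Ω) [IsProbabilityMeasure P]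
      (ℱ : Filtration ℕ mΩ) (X : ℕ → Fin M → Fin N → Ω → ℝ)
      (a : ℕ → Fin M → Ω → Finset (Fin N)),
      IsRewardProcess P ℱ μ X →
      ∀ i, Function.Injective (μ i) → FollowsUPart ℱ K α X a i → ∀ T : ℕ,
        weakRegret P K μ X a i T
          ≤ ∑ j ∈ (topOptions K (μ i))ᶜ, c * Real.log T / gap K (μ i) j + C := by
  have hc_pos : 0 < c := by linarith
  set κ : ℝ := 2 / √c
  have hκ : 0 < κ := by positivity
  have hκ1 : κ < 1 := (div_lt_one (by positivity)).2 (Real.lt_sqrt_of_sq_lt (by linarith))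
  have hκc : 4 / κ ^ 2 = c := by
    rw [div_pow, Real.sq_sqrt hc_pos.le]
    field_simp
    norm_num
  have hpenalty : ∀ᶠ t : ℕ in atTop, ∀ i, ∀ j ∉ topOptions K (μ i),
      |α| * √(Real.log t / t) ≤ (1 - κ) * gap K (μ i) j / 2 := by
    refine eventually_all.2 fun i => eventually_all.2 fun j =>
      eventually_imp_distrib_left.2 fun hj =>
        (tendsto_mul_sqrt_log_div |α|).eventually_le_const ?_
    exact half_pos (mul_pos (sub_pos.2 hκ1) (gap_pos hK hj))
  obtain ⟨t₀, ht₀⟩ := eventually_atTop.1 hpenalty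
  obtain ⟨C, hC⟩ := (Set.finite_range fun i => ∑ j ∈ (topOptions K (μ i))ᶜ,
    (1 + misleadingBound N ((1 - κ) * gap K (μ i) j / 2) t₀)).bddAbove
  refine ⟨C, fun P _ ℱ X a hX i hinj ha T => ?_⟩
  have hregret := ha.weakRegret_le hK hX hinj hκ hκ1 (fun t ht => ht₀ t ht i) T
  rw [hκc] at hregret
  exact hregret.trans (add_le_add_right (hC (Set.mem_range_self i)) _)

theorem mainTheorem2 {M N K : ℕ} (hK : 1 ≤ K) (hKN : K ≤ N)
    (μ : Fin M → Fin N → ℝ) (hμ : GroupLearning.UniformPreference μ)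
    (α : ℝ) (hα : 0 ≤ α) (ε : ℝ) (hε : 0 < ε) :
    ∃ C : ℝ, ∀ {Ω : Type*} [mΩ : MeasurableSpace Ω] (P : Measure Ω) [IsProbabilityMeasure P]
      (ℱ : Filtration ℕ mΩ) (X : ℕ → Fin M → Fin N → Ω → ℝ)
      (a : ℕ → Fin M → Ω → Finset (Fin N)),
      GroupLearning.IsRewardProcess P ℱ μ X → GroupLearning.IsUPart ℱ K α X a →
      ∀ (i : Fin M) (t : ℕ), 1 ≤ t →
        GroupLearning.weakRegret P K μ X a i t ≤
          (∑ j ∈ (GroupLearning.topOptions K (μ i))ᶜ,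
            (⌈(6 + ε) * Real.log t / GroupLearning.gap K (μ i) j⌉ : ℝ)) + C := by
  obtain ⟨C, hC⟩ := mainTheorem2_general hK μ α (c := 6 + ε) (by linarith)
  exact ⟨C, fun P _ ℱ X a hX ha i t _ =>
    (hC P ℱ X a hX i (hμ.distinct i) (ha.followsUPart i) t).trans
      (add_le_add_left (Finset.sum_le_sum fun _ _ => Int.le_ceil _) C)⟩
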